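/- For $q\in(1,2)$ and $x\in I_q:=[0,1/(q-1)]$, a $q$-expansion of $x$ is a sequence $(d_i)_{i\ge1}\in\{0,1\}^{\mathbb N}$ with $x=\sum_{i=1}^\infty d_i q^{-i}$. Let $\mathcal B_2$ be the set of $q\in(1,2)$ for which some $x\in I_q$ has exactly two different $q$-expansions. Then $\mathcal B_2$ has a smallest element; denote it by $q_2$ (numerically $q_2\approx 1.71064$). For $k\ge 1$ let $\mathcal M_k$ be the set of $x\in I_{q_2}$ having exactly $k$ different $q_2$-expansions. Then the set of all accumulation points (in $\mathbb R$) of $\mathcal M_2$ is exactly $\mathcal M_1$. Moreover, $\mathcal M_2$ is discrete (in its subspace topology), countably infinite, and not closed in $\mathbb R$. -/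

import Mathlib

noncomputable section

namespace BaseExpansion

/-- `expansions q x` is the set of all `q`-expansions of `x`, i.e. of all sequences of digits
`d₁, d₂, … ∈ {0, 1}` with `x = ∑_{i ≥ 1} dᵢ / q ^ i`. The digit `dᵢ` is stored as `d (i - 1)`. -/
def expansions (q x : ℝ) : Set (ℕ → Fin 2) :=
  {d | HasSum (fun i : ℕ => ((d i : ℕ) : ℝ) / q ^ (i + 1)) x}

/-- The set of `x ∈ I_q = [0, 1 / (q - 1)]` having exactly `k` different `q`-expansions. -/
def pointsWith (q : ℝ) (k : ℕ) : Set ℝ :=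
  {x | x ∈ Set.Icc 0 (1 / (q - 1)) ∧ (expansions q x).encard = k}

/-- `basesWith m` is `𝓑_m`: the set of bases `q ∈ (1, 2)` for which some `x ∈ I_q` has exactly `m`
different `q`-expansions. -/
def basesWith (m : ℕ) : Set ℝ :=
  {q | q ∈ Set.Ioo 1 2 ∧ (pointsWith q m).Nonempty}

/-- `q₂ ≈ 1.71064`, the smallest base in which some number has exactly two expansions. It is
written as an infimum; that the infimum is attained is part of the theorem. -/
def q₂ : ℝ := sInf (basesWith 2)

/-- `M k` is the set of `x ∈ I_{q₂}` having exactly `k` different `q₂`-expansions. -/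
def M (k : ℕ) : Set ℝ := pointsWith q₂ k

end BaseExpansion

end

open Filter Topology Set

namespace BaseExpansion

/-! Splitting by the first digit, the number of expansions of `x` is the sum of those of `q * x` and
`q * x - 1` (`encard_expansions`). On `I_q` both branches survive exactly when `1 ≤ q * x ≤ 1 / (q -
1)`, the switch region. A set that avoids this region and is stable under the forced branch consists
of points with one expansion (`encard_eq_one_of_invariant`). So a point with two expansions yields
`v` and `v + 1` with one expansion each (`exists_encard_one_pair`).

If `q * (q - 1) ^ 2 < 1`, the points with one expansion are the endpoints and, when α = `altValue q`
is below 1, the points α / q^(k+1) and their reflections (`encard_one_classification`). A pair `v`,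
`v + 1` then means q^(-j) + q^(-k) = (2 - q)(q + 1). While P(q) = q⁴ - 2q² - q - 1 ≤ 0, this forces
P(q) = 0 and {j, k} = {1, 3} (`inv_pow_add_inv_pow_eq`), so `q₂` is the root of P.

In that base the accumulation points of `M 2` themselves form an invariant set, so they lie in `M 1`
(`accPt_subset`). Conversely, prepending blocks 01 and then zeros to a point of `M 2` approaches
every α / q^(k+1), and reflection gives the rest (`subset_closure`). Since `M 1` and `M 2` are
disjoint and 0 lies in `M 1`, the topological claims follow. -/

/-! ### Digit recursion for the set of expansions. -/

lemma mem_expansions_iff_tail {q : ℝ} (hq : 1 < q) (x : ℝ) (d : ℕ → Fin 2) :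
    d ∈ expansions q x ↔
      (fun n => d (n + 1)) ∈ expansions q (q * x - ((d 0 : ℕ) : ℝ)) := by
  have hq0 : q ≠ 0 := by positivity
  unfold expansions
  simp only [mem_ofPred_eq]
  rw [← hasSum_nat_add_iff' 1, ← hasSum_mul_left_iff hq0]
  have h1 : (fun i => q * (((d (i + 1) : ℕ) : ℝ) / q ^ (i + 1 + 1)))
      = fun i => ((d (i + 1) : ℕ) : ℝ) / q ^ (i + 1) := by
    funext i
    rw [pow_succ q (i + 1)]
    field_simp
  have h2 : q * (x - ∑ i ∈ Finset.range 1, ((d i : ℕ) : ℝ) / q ^ (i + 1))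
      = q * x - ((d 0 : ℕ) : ℝ) := by
    simp
    field_simp
  rw [h1, h2]

/-- Prepend a digit to a digit sequence. -/
def consDigit (a : Fin 2) (d : ℕ → Fin 2) : ℕ → Fin 2
  | 0 => a
  | n + 1 => d n

lemma consDigit_injective (a : Fin 2) : Function.Injective (consDigit a) := by
  intro d e h
  funext n
  exact congrFun h (n + 1)

lemma expansions_eq_union {q : ℝ} (hq : 1 < q) (x : ℝ) :
    expansions q x =
      consDigit 0 '' expansions q (q * x) ∪ consDigit 1 '' expansions q (q * x - 1) := by
  ext d
  rw [mem_expansions_iff_tail hq]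
  have key : ∀ a : Fin 2, ∀ y, d ∈ consDigit a '' expansions q y ↔
      d 0 = a ∧ (fun n => d (n + 1)) ∈ expansions q y := by
    intro a y
    constructor
    · rintro ⟨e, he, rfl⟩
      exact ⟨rfl, he⟩
    · rintro ⟨h0, h⟩
      refine ⟨_, h, ?_⟩
      funext n
      cases n with
      | zero => exact h0.symm
      | succ n => rfl
  rw [mem_union, key, key]
  have h2 : d 0 = 0 ∨ d 0 = 1 := by omega
  rcases h2 with h | h <;> simp [h]

lemma encard_expansions {q : ℝ} (hq : 1 < q) (x : ℝ) :
    (expansions q x).encard =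
      (expansions q (q * x)).encard + (expansions q (q * x - 1)).encard := by
  rw [expansions_eq_union hq, encard_union_eq, (consDigit_injective 0).encard_image,
    (consDigit_injective 1).encard_image]
  rw [Set.disjoint_left]
  rintro _ ⟨d, -, rfl⟩ ⟨e, -, h⟩
  exact absurd (congrFun h 0) (by simp [consDigit])

lemma hasSum_ones {q : ℝ} (hq : 1 < q) :
    HasSum (fun i : ℕ => 1 / q ^ (i + 1)) (1 / (q - 1)) := by
  have h := (hasSum_geometric_of_lt_one (r := 1 / q) (by positivity)
    (by rw [div_lt_one] <;> linarith)).mul_left (1 / q)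
  have h0 : q - 1 ≠ 0 := by linarith
  have h1 : 1 / q * (1 - 1 / q)⁻¹ = 1 / (q - 1) := by
    field_simp
  rw [h1] at h
  have h2 : (fun i : ℕ => 1 / q ^ (i + 1)) = fun i => 1 / q * (1 / q) ^ i := by
    funext i
    rw [div_pow, one_pow, pow_succ]
    field_simp
  rwa [h2]

lemma digit_le_one (a : Fin 2) : ((a : ℕ) : ℝ) ≤ 1 := by
  have : (a : ℕ) ≤ 1 := by omega
  exact_mod_cast this

lemma mem_Icc_of_mem_expansions {q x : ℝ} (hq : 1 < q) {d : ℕ → Fin 2}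
    (hd : d ∈ expansions q x) : x ∈ Icc 0 (1 / (q - 1)) := by
  refine ⟨HasSum.nonneg (fun i => by positivity) hd, hasSum_le (fun i => ?_) hd (hasSum_ones hq)⟩
  gcongr
  exact digit_le_one _

lemma encard_eq_zero_of_notMem {q x : ℝ} (hq : 1 < q) (hx : x ∉ Icc 0 (1 / (q - 1))) :
    (expansions q x).encard = 0 := by
  rw [encard_eq_zero, eq_empty_iff_forall_notMem]
  exact fun d hd => hx (mem_Icc_of_mem_expansions hq hd)

/-! ### Existence of expansions. -/

/-- The greedy digit map. -/
noncomputable def greedyStep (q x : ℝ) : ℝ := if 1 ≤ q * x then q * x - 1 else q * x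

lemma greedyStep_mem {q x : ℝ} (hq : 1 < q) (hq2 : q < 2) (hx : x ∈ Icc 0 (1 / (q - 1))) :
    greedyStep q x ∈ Icc 0 (1 / (q - 1)) := by
  obtain ⟨h0, h1⟩ := hx
  have hr : q * (1 / (q - 1)) - 1 = 1 / (q - 1) := by
    have : q - 1 ≠ 0 := by linarith
    field_simp
    ring
  have hr1 : 1 ≤ 1 / (q - 1) := by
    rw [le_div_iff₀] <;> linarith
  have hm : q * x ≤ q * (1 / (q - 1)) := by gcongr
  unfold greedyStep
  split_ifs with h
  · exact ⟨by linarith, by linarith⟩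
  · exact ⟨by positivity, by linarith⟩

lemma expansions_nonempty {q x : ℝ} (hq : 1 < q) (hq2 : q < 2)
    (hx : x ∈ Icc 0 (1 / (q - 1))) : (expansions q x).Nonempty := by
  have hq0 : q ≠ 0 := by positivity
  have ht : ∀ n, (greedyStep q)^[n] x ∈ Icc 0 (1 / (q - 1)) := by
    intro n
    induction n with
    | zero => exact hx
    | succ n ih =>
      rw [Function.iterate_succ_apply']
      exact greedyStep_mem hq hq2 ih
  let d : ℕ → Fin 2 := fun n => if 1 ≤ q * (greedyStep q)^[n] x then 1 else 0
  refine ⟨d, ?_⟩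
  have hpart : ∀ n, ∑ i ∈ Finset.range n, ((d i : ℕ) : ℝ) / q ^ (i + 1)
      = x - (greedyStep q)^[n] x / q ^ n := by
    intro n
    induction n with
    | zero => simp
    | succ n ih =>
      rw [Finset.sum_range_succ, ih, Function.iterate_succ_apply']
      simp only [d, greedyStep]
      split_ifs with h
      · simp only [Fin.val_one, Nat.cast_one]
        field_simp
        ring
      · simp only [Fin.val_zero, Nat.cast_zero]
        field_simp
        ring
  change HasSum _ _
  rw [hasSum_iff_tendsto_nat_of_nonneg (fun i => by positivity)]
  simp only [hpart]
  have hz : Tendsto (fun n => (greedyStep q)^[n] x / q ^ n) atTop (𝓝 0) := by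
    have hb : Tendsto (fun n : ℕ => (1 / (q - 1)) / q ^ n) atTop (𝓝 0) :=
      tendsto_const_nhds.div_atTop (tendsto_pow_atTop_atTop_of_one_lt hq)
    refine squeeze_zero (fun n => ?_) (fun n => ?_) hb
    · have := (ht n).1
      positivity
    · have := (ht n).2
      gcongr
  simpa using hz.const_sub x

lemma one_le_encard {q x : ℝ} (hq : 1 < q) (hq2 : q < 2) (hx : x ∈ Icc 0 (1 / (q - 1))) :
    1 ≤ (expansions q x).encard :=
  one_le_encard_iff_nonempty.2 (expansions_nonempty hq hq2 hx)

/-! ### Reflection, and counting expansions near the switch region. -/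

/-- Interchange the digits `0` and `1`. -/
def flipDigits (d : ℕ → Fin 2) : ℕ → Fin 2 := fun n => Fin.rev (d n)

lemma flipDigits_flipDigits (d : ℕ → Fin 2) : flipDigits (flipDigits d) = d := by
  funext n
  simp [flipDigits]

lemma flipDigits_mem {q x : ℝ} (hq : 1 < q) {d : ℕ → Fin 2} (hd : d ∈ expansions q x) :
    flipDigits d ∈ expansions q (1 / (q - 1) - x) := by
  have h := (hasSum_ones hq).sub hd
  change HasSum _ _
  have h1 : (fun i : ℕ => ((flipDigits d i : ℕ) : ℝ) / q ^ (i + 1))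
      = fun i => 1 / q ^ (i + 1) - ((d i : ℕ) : ℝ) / q ^ (i + 1) := by
    funext i
    have h2 : d i = 0 ∨ d i = 1 := by omega
    rcases h2 with h | h <;> simp [flipDigits, h]
  rwa [h1]

lemma encard_expansions_reflect {q : ℝ} (hq : 1 < q) (x : ℝ) :
    (expansions q (1 / (q - 1) - x)).encard = (expansions q x).encard := by
  have hle : ∀ y, (expansions q y).encard ≤ (expansions q (1 / (q - 1) - y)).encard := by
    intro y
    rw [← (Function.LeftInverse.injective flipDigits_flipDigits).encard_image]
    apply encard_le_encard
    rintro _ ⟨d, hd, rfl⟩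
    exact flipDigits_mem hq hd
  refine le_antisymm ?_ (hle x)
  have := hle (1 / (q - 1) - x)
  rwa [sub_sub_cancel] at this

lemma mem_Icc_of_encard_eq {q x : ℝ} (hq : 1 < q) {k : ℕ} (hk : k ≠ 0)
    (h : (expansions q x).encard = k) : x ∈ Icc 0 (1 / (q - 1)) := by
  by_contra hx
  rw [encard_eq_zero_of_notMem hq hx] at h
  exact hk (by exact_mod_cast h.symm)

lemma mem_pointsWith {q x : ℝ} (hq : 1 < q) {k : ℕ} (hk : k ≠ 0) :
    x ∈ pointsWith q k ↔ (expansions q x).encard = k :=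
  ⟨fun h => h.2, fun h => ⟨mem_Icc_of_encard_eq hq hk h, h⟩⟩

/-- A set whose points never enter the switch region consists of points with one expansion. -/
lemma encard_eq_one_of_invariant {q : ℝ} (hq : 1 < q) (hq2 : q < 2) {D : Set ℝ}
    (hI : D ⊆ Icc 0 (1 / (q - 1)))
    (hD : ∀ x ∈ D, (q * x < 1 ∧ q * x ∈ D) ∨ (1 / (q - 1) < q * x ∧ q * x - 1 ∈ D))
    {x : ℝ} (hx : x ∈ D) : (expansions q x).encard = 1 := by
  have huniq : ∀ n : ℕ, ∀ x ∈ D, ∀ d ∈ expansions q x, ∀ e ∈ expansions q x, d n = e n := by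
    have step : ∀ x ∈ D, ∃ a : Fin 2, q * x - ((a : ℕ) : ℝ) ∈ D ∧
        ∀ d ∈ expansions q x, d 0 = a := by
      intro x hx
      rcases hD x hx with ⟨h1, h2⟩ | ⟨h1, h2⟩
      · refine ⟨0, by simpa using h2, fun d hd => ?_⟩
        by_contra hne
        have h3 : d 0 = 1 := by omega
        have h4 := mem_Icc_of_mem_expansions hq ((mem_expansions_iff_tail hq x d).1 hd)
        rw [h3] at h4
        have := h4.1
        simp at this
        linarith
      · refine ⟨1, by simpa using h2, fun d hd => ?_⟩
        by_contra hne
        have h3 : d 0 = 0 := by omega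
        have h4 := mem_Icc_of_mem_expansions hq ((mem_expansions_iff_tail hq x d).1 hd)
        rw [h3] at h4
        have := h4.2
        simp only [Fin.val_zero, Nat.cast_zero, sub_zero] at this
        linarith
    intro n
    induction n with
    | zero =>
      intro x hx d hd e he
      obtain ⟨a, -, h⟩ := step x hx
      rw [h d hd, h e he]
    | succ n ih =>
      intro x hx d hd e he
      obtain ⟨a, ha, h⟩ := step x hx
      have hd' := (mem_expansions_iff_tail hq x d).1 hd
      have he' := (mem_expansions_iff_tail hq x e).1 he
      rw [h d hd] at hd'
      rw [h e he] at he'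
      exact ih _ ha _ hd' _ he'
  obtain ⟨d, hd⟩ := expansions_nonempty hq hq2 (hI hx)
  rw [encard_eq_one]
  refine ⟨d, eq_singleton_iff_unique_mem.2 ⟨hd, fun e he => ?_⟩⟩
  funext n
  exact huniq n x hx e he d hd

lemma encard_cons_zero {q x : ℝ} (hq : 1 < q) (hx : x < 1) :
    (expansions q (x / q)).encard = (expansions q x).encard := by
  rw [encard_expansions hq, mul_div_cancel₀ x (by positivity),
    encard_eq_zero_of_notMem hq (x := x - 1) (fun h => by linarith [h.1]), add_zero]

lemma encard_cons_one {q x : ℝ} (hq : 1 < q) (hx : 1 / (q - 1) < x + 1) :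
    (expansions q ((x + 1) / q)).encard = (expansions q x).encard := by
  rw [encard_expansions hq, mul_div_cancel₀ (x + 1) (by positivity), add_sub_cancel_right,
    encard_eq_zero_of_notMem hq (x := x + 1) (fun h => by linarith [h.2]), zero_add]

lemma encard_mul_of_lt {q x : ℝ} (hq : 1 < q) (hx : q * x < 1) :
    (expansions q (q * x)).encard = (expansions q x).encard := by
  rw [encard_expansions hq x,
    encard_eq_zero_of_notMem hq (x := q * x - 1) (fun h => by linarith [h.1]), add_zero]

lemma encard_mul_sub_one_of_lt {q x : ℝ} (hq : 1 < q) (hx : 1 / (q - 1) < q * x) :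
    (expansions q (q * x - 1)).encard = (expansions q x).encard := by
  rw [encard_expansions hq x,
    encard_eq_zero_of_notMem hq (x := q * x) (fun h => by linarith [h.2]), zero_add]

lemma one_le_encard_of_switch {q x : ℝ} (hq : 1 < q) (hq2 : q < 2)
    (h1 : 1 ≤ q * x) (h2 : q * x ≤ 1 / (q - 1)) :
    1 ≤ (expansions q (q * x)).encard ∧ 1 ≤ (expansions q (q * x - 1)).encard :=
  ⟨one_le_encard hq hq2 ⟨by linarith, h2⟩, one_le_encard hq hq2 ⟨by linarith, by linarith⟩⟩

lemma encard_one_cases {q x : ℝ} (hq : 1 < q) (hq2 : q < 2)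
    (h : (expansions q x).encard = 1) : q * x < 1 ∨ 1 / (q - 1) < q * x := by
  by_contra! hc
  obtain ⟨h1, h2⟩ := one_le_encard_of_switch hq hq2 hc.1 hc.2
  have h3 := add_le_add h1 h2
  rw [← encard_expansions hq, h] at h3
  norm_num at h3

lemma encard_two_cases {q x : ℝ} (hq : 1 < q) (hq2 : q < 2)
    (h : (expansions q x).encard = 2) : q * x < 1 ∨ 1 / (q - 1) < q * x ∨
      ((expansions q (q * x)).encard = 1 ∧ (expansions q (q * x - 1)).encard = 1) := by
  by_contra! hc
  obtain ⟨h1, h2⟩ := one_le_encard_of_switch hq hq2 hc.1 hc.2.1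
  rw [encard_expansions hq] at h
  have hc := hc.2.2
  generalize (expansions q (q * x)).encard = A at *
  generalize (expansions q (q * x - 1)).encard = B at *
  have hA : A ≠ ⊤ := by rintro rfl; simp at h
  have hB : B ≠ ⊤ := by rintro rfl; simp at h
  lift A to ℕ using hA
  lift B to ℕ using hB
  norm_cast at *
  exact hc (by omega) (by omega)

/-- If some point has two expansions, then two points at distance one have a unique expansion. -/
lemma exists_encard_one_pair {q x : ℝ} (hq : 1 < q) (hq2 : q < 2)
    (h : (expansions q x).encard = 2) :
    ∃ v, (expansions q v).encard = 1 ∧ (expansions q (v + 1)).encard = 1 := by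
  -- Without such a pair, no point with two expansions could branch into two single ones, so these
  -- points would form an invariant set and have only one expansion.
  by_contra! hc
  have := encard_eq_one_of_invariant hq hq2 (D := {y | (expansions q y).encard = 2})
    (fun y hy => mem_Icc_of_encard_eq hq (k := 2) (by norm_num) hy) (fun y hy => ?_) h
  · rw [h] at this
    norm_num at this
  · rcases encard_two_cases hq hq2 hy with h1 | h1 | ⟨h1, h2⟩
    · exact Or.inl ⟨h1, (encard_mul_of_lt hq h1).trans hy⟩
    · exact Or.inr ⟨h1, (encard_mul_sub_one_of_lt hq h1).trans hy⟩
    · exact absurd (by simpa using h1) (hc _ h2)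

/-! ### Points with a unique expansion when `q * (q - 1) ^ 2 < 1`. -/

/-- The value of the periodic expansion `(10)^∞` in base `q`. -/
noncomputable def altValue (q : ℝ) : ℝ := q / (q ^ 2 - 1)

lemma altValue_pos {q : ℝ} (hq : 1 < q) : 0 < altValue q :=
  div_pos (by linarith) (by nlinarith)

/-- The condition says that `q` exceeds the golden ratio. -/
lemma altValue_lt_one_iff {q : ℝ} (hq : 1 < q) : altValue q < 1 ↔ 0 < q ^ 2 - q - 1 := by
  have h : 0 < q ^ 2 - 1 := by nlinarith
  rw [altValue, div_lt_one h]
  constructor <;> intro h <;> linarith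

lemma sub_altValue_div {q : ℝ} (hq : 1 < q) :
    1 / (q - 1) - altValue q / q = altValue q := by
  have h : q ^ 2 - 1 = (q - 1) * (q + 1) := by ring
  have h1 : q - 1 ≠ 0 := by linarith
  have h2 : q + 1 ≠ 0 := by linarith
  rw [altValue, h]
  field_simp
  ring

lemma encard_zero_eq_one {q : ℝ} (hq : 1 < q) (hq2 : q < 2) :
    (expansions q 0).encard = 1 := by
  have hr : 0 ≤ 1 / (q - 1) := by
    have : 0 < q - 1 := by linarith
    positivity
  refine encard_eq_one_of_invariant hq hq2 (D := {0}) ?_ ?_ rfl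
  · rintro _ rfl
    exact ⟨le_rfl, hr⟩
  · rintro _ rfl
    left
    simp

lemma encard_altValue_div {q : ℝ} (hq : 1 < q) (hq2 : q < 2) (ha : altValue q < 1)
    (k : ℕ) : (expansions q (altValue q / q ^ (k + 1))).encard = 1 := by
  have hpos := altValue_pos hq
  have hr := sub_altValue_div hq
  have hq0 : q ≠ 0 := by positivity
  have hdiv : 0 < altValue q / q := by positivity
  have hmul : q * altValue q - 1 = altValue q / q := by
    have h : q ^ 2 - 1 ≠ 0 := by nlinarith
    rw [altValue]
    field_simp
    ring
  have hle : altValue q / q ≤ altValue q := div_le_self hpos.le hq.le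
  induction k with
  | zero =>
    rw [zero_add, pow_one]
    refine encard_eq_one_of_invariant hq hq2 (D := {altValue q / q, altValue q}) ?_ ?_ (by simp)
    · rintro _ (rfl | rfl)
      · exact ⟨hdiv.le, by linarith⟩
      · exact ⟨hpos.le, by linarith⟩
    · rintro _ (rfl | rfl)
      · left
        rw [mul_div_cancel₀ _ hq0]
        exact ⟨ha, by simp⟩
      · right
        rw [hmul]
        exact ⟨by linarith, by simp⟩
  | succ k ih =>
    rw [pow_succ, ← div_div, encard_cons_zero hq, ih]
    exact (div_le_self hpos.le (one_le_pow₀ hq.le)).trans_lt ha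

/-- Below 1 and right of the switch region, the digits 1, 0 are forced and the orbit returns to the
same range. A repeated 1 or a second 0 would each contradict `q * (q - 1) ^ 2 < 1`. -/
lemma two_step {q z : ℝ} (hq : 1 < q) (hq2 : q < 2) (hf : q * (q - 1) ^ 2 < 1)
    (hz : (expansions q z).encard = 1) (hz1 : 1 / (q - 1) < q * z) (hz2 : z < 1) :
    (expansions q (q * (q * z - 1))).encard = 1 ∧
      1 / (q - 1) < q * (q * (q * z - 1)) ∧ q * (q * z - 1) < 1 := by
  have hq1 : 0 < q - 1 := by linarith
  have h1 := (encard_mul_sub_one_of_lt hq hz1).trans hz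
  have h2 : q * (q * z - 1) < 1 := by
    rcases encard_one_cases hq hq2 h1 with h | h
    · exact h
    · exfalso
      rw [div_lt_iff₀ hq1] at h
      have : q * (q * z - 1) ≤ q * (q - 1) := by
        gcongr
        nlinarith
      nlinarith
  have h3 := (encard_mul_of_lt hq h2).trans h1
  refine ⟨h3, ?_, h2⟩
  rcases encard_one_cases hq hq2 h3 with h | h
  · exfalso
    rw [div_lt_iff₀ hq1] at hz1
    have h4 : q ^ 2 * (q * z - 1) * (q - 1) < q - 1 := by nlinarith
    have h5 : q ^ 2 * 1 < q ^ 2 * (q * z * (q - 1)) := by gcongr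
    nlinarith
  · exact h

/-- The double step `z ↦ q * (q * z - 1)` fixes `altValue q` and multiplies the distance to it by `q
^ 2`, whereas the orbit stays bounded. -/
lemma eq_altValue_of_right {q z : ℝ} (hq : 1 < q) (hq2 : q < 2) (hf : q * (q - 1) ^ 2 < 1)
    (hz : (expansions q z).encard = 1) (hz1 : 1 / (q - 1) < q * z) (hz2 : z < 1) :
    z = altValue q := by
  set a := altValue q with ha
  have hfix : q * (q * a - 1) = a := by
    have h : q ^ 2 - 1 ≠ 0 := by nlinarith
    rw [ha, altValue]
    field_simp
    ring
  have horb : ∀ n : ℕ, (expansions q (a + (q ^ 2) ^ n * (z - a))).encard = 1 ∧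
      1 / (q - 1) < q * (a + (q ^ 2) ^ n * (z - a)) ∧ a + (q ^ 2) ^ n * (z - a) < 1 := by
    intro n
    induction n with
    | zero => simpa using ⟨hz, by simpa using hz1, hz2⟩
    | succ n ih =>
      have h := two_step hq hq2 hf ih.1 ih.2.1 ih.2.2
      have he : q * (q * (a + (q ^ 2) ^ n * (z - a)) - 1) = a + (q ^ 2) ^ (n + 1) * (z - a) := by
        rw [pow_succ]
        linear_combination hfix
      rwa [he] at h
  by_contra hne
  have hd : 0 < |z - a| := abs_pos.2 (sub_ne_zero.2 hne)
  obtain ⟨n, hn⟩ := pow_unbounded_of_one_lt ((a + 1) / |z - a|) (show 1 < q ^ 2 by nlinarith)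
  rw [div_lt_iff₀ hd] at hn
  obtain ⟨h1, h2, h3⟩ := horb n
  have h4 := (mem_Icc_of_encard_eq hq (k := 1) one_ne_zero (h1.trans Nat.cast_one.symm)).1
  have hapos := altValue_pos hq
  have h5 : (q ^ 2) ^ n * |z - a| = |(q ^ 2) ^ n * (z - a)| := by
    rw [abs_mul, abs_of_pos (a := (q ^ 2) ^ n) (by positivity)]
  rw [h5] at hn
  have : |(q ^ 2) ^ n * (z - a)| ≤ a + 1 := abs_le.2 ⟨by linarith, by linarith⟩
  linarith

lemma eq_altValue_div_of_left {q x : ℝ} (hq : 1 < q) (hq2 : q < 2) (hf : q * (q - 1) ^ 2 < 1)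
    (hx : (expansions q x).encard = 1) (hx0 : 0 < x) (hx1 : q * x < 1) :
    altValue q < 1 ∧ ∃ k : ℕ, x = altValue q / q ^ (k + 1) := by
  have hex : ∃ k : ℕ, 1 ≤ q * (q ^ k * x) := by
    obtain ⟨n, hn⟩ := pow_unbounded_of_one_lt (1 / x) hq
    rw [div_lt_iff₀ hx0] at hn
    exact ⟨n, by nlinarith⟩
  classical
  -- Take the first time the orbit under multiplication by `q` leaves the region left of the switch;
  -- there it must equal `altValue q`.
  obtain ⟨k, hk, hmin⟩ : ∃ k : ℕ, 1 ≤ q * (q ^ k * x) ∧ ∀ j < k, q * (q ^ j * x) < 1 :=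
    ⟨Nat.find hex, Nat.find_spec hex, fun j hj => not_le.1 (Nat.find_min hex hj)⟩
  have hN : ∀ j ≤ k, (expansions q (q ^ j * x)).encard = 1 := by
    intro j
    induction j with
    | zero => simpa using hx
    | succ j ih =>
      intro hj
      have h := encard_mul_of_lt hq (hmin j (by omega))
      rw [ih (by omega)] at h
      rwa [pow_succ', mul_assoc]
  obtain _ | k := k
  · simp at hk
    linarith
  have hlt : q ^ (k + 1) * x < 1 := by
    have := hmin k (by omega)
    rwa [← mul_assoc, ← pow_succ'] at this
  have hz : q ^ (k + 1) * x = altValue q := by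
    refine eq_altValue_of_right hq hq2 hf (hN _ le_rfl) ?_ hlt
    rcases encard_one_cases hq hq2 (hN _ le_rfl) with h | h
    · linarith
    · exact h
  refine ⟨hz ▸ hlt, k, ?_⟩
  rw [← hz]
  field_simp

lemma encard_one_classification {q x : ℝ} (hq : 1 < q) (hq2 : q < 2)
    (hf : q * (q - 1) ^ 2 < 1) (hx : (expansions q x).encard = 1) :
    x = 0 ∨ x = 1 / (q - 1) ∨ (altValue q < 1 ∧ ∃ k : ℕ, x = altValue q / q ^ (k + 1) ∨
      x = 1 / (q - 1) - altValue q / q ^ (k + 1)) := by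
  obtain ⟨h0, h1⟩ := mem_Icc_of_encard_eq hq (k := 1) one_ne_zero (hx.trans Nat.cast_one.symm)
  rcases h0.eq_or_lt with h0 | h0
  · exact Or.inl h0.symm
  rcases h1.eq_or_lt with h1 | h1
  · exact Or.inr (Or.inl h1)
  right; right
  rcases encard_one_cases hq hq2 hx with h | h
  · obtain ⟨ha, k, hk⟩ := eq_altValue_div_of_left hq hq2 hf hx h0 h
    exact ⟨ha, k, Or.inl hk⟩
  · have hr : q * (1 / (q - 1)) = 1 / (q - 1) + 1 := by
      have : q - 1 ≠ 0 := by linarith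
      field_simp
      ring
    obtain ⟨ha, k, hk⟩ := eq_altValue_div_of_left hq hq2 hf (x := 1 / (q - 1) - x)
      ((encard_expansions_reflect hq x).trans hx) (by linarith) (by rw [mul_sub]; linarith)
    exact ⟨ha, k, Or.inr (by linarith)⟩

/-! ### The critical base as root of a quartic. -/

section Equation

variable {q : ℝ}

lemma lt_of_quartic_nonpos (hq : 1 < q) (hP : q ^ 4 - 2 * q ^ 2 - q - 1 ≤ 0) : q < 1.72 := by
  by_contra! h
  nlinarith [mul_self_nonneg (q - 1.72), mul_self_nonneg (q ^ 2 - 1.72 ^ 2)]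

lemma mul_sub_one_sq_lt_one (hq : 1 < q) (h : q < 1.72) : q * (q - 1) ^ 2 < 1 := by
  have : (q - 1) ^ 2 ≤ 0.72 ^ 2 := by
    apply pow_le_pow_left₀ <;> linarith
  nlinarith

lemma inv_add_inv_cube_le (hq : 1 < q) (hP : q ^ 4 - 2 * q ^ 2 - q - 1 ≤ 0) :
    1 / q + (1 / q) ^ 3 ≤ (2 - q) * (q + 1) := by
  have h : (2 - q) * (q + 1) - (1 / q + (1 / q) ^ 3)
      = (q - 1) * (-(q ^ 4 - 2 * q ^ 2 - q - 1)) / q ^ 3 := by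
    field_simp
    ring
  have : 0 ≤ (q - 1) * (-(q ^ 4 - 2 * q ^ 2 - q - 1)) / q ^ 3 := by
    apply div_nonneg (mul_nonneg _ _) <;> first | linarith | positivity
  linarith

lemma inv_pow_ne (hq : 1 < q) (hG : 0 < q ^ 2 - q - 1)
    (hP : q ^ 4 - 2 * q ^ 2 - q - 1 ≤ 0) (l : ℕ) : (1 / q) ^ l ≠ (2 - q) * (q + 1) := by
  intro h
  have h1 := inv_add_inv_cube_le hq hP
  have ht : 1 / q ≤ 1 := by rw [div_le_one] <;> linarith
  obtain _ | l := l
  · simp at h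
    nlinarith
  · have h2 : (1 / q) ^ (l + 1) ≤ (1 / q) ^ 1 :=
      pow_le_pow_of_le_one (by positivity) ht (by omega)
    have h3 : 0 < (1 / q) ^ 3 := by positivity
    linarith

/-- The right side is below 1 and at least 1/q + 1/q³. Large exponents make the left side too small
and small ones too large. The exponents (1, 2) would give `(q ^ 2 - q - 1) * (q ^ 2 - 1) = 0`. -/
lemma inv_pow_add_inv_pow_eq (hq : 1 < q) (hq2 : q < 2) (hG : 0 < q ^ 2 - q - 1)
    (hP : q ^ 4 - 2 * q ^ 2 - q - 1 ≤ 0) {i l : ℕ} (hil : i ≤ l)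
    (h : (1 / q) ^ i + (1 / q) ^ l = (2 - q) * (q + 1)) :
    q ^ 4 - 2 * q ^ 2 - q - 1 = 0 ∧ i = 1 ∧ l = 3 := by
  have h1 := inv_add_inv_cube_le hq hP
  have ht : 1 / q < 1 := by rw [div_lt_one] <;> linarith
  have ht0 : 0 < 1 / q := by positivity
  have anti : ∀ {m n : ℕ}, m ≤ n → (1 / q) ^ n ≤ (1 / q) ^ m :=
    fun hmn => pow_le_pow_of_le_one ht0.le ht.le hmn
  obtain rfl | rfl | hi : i = 0 ∨ i = 1 ∨ 2 ≤ i := by omega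
  · have : 0 < (1 / q) ^ l := by positivity
    simp only [pow_zero] at h
    nlinarith
  · obtain rfl | rfl | rfl | hl : l = 1 ∨ l = 2 ∨ l = 3 ∨ 4 ≤ l := by omega
    · exfalso
      have : 1 / 2 < 1 / q := by
        apply one_div_lt_one_div_of_lt <;> linarith
      simp only [pow_one] at h
      nlinarith
    · exfalso
      field_simp at h
      have : 0 < (q ^ 2 - q - 1) * (q ^ 2 - 1) := mul_pos hG (by nlinarith)
      nlinarith
    · refine ⟨?_, rfl, rfl⟩
      field_simp at h
      have h3 : (q - 1) * (q ^ 4 - 2 * q ^ 2 - q - 1) = 0 := by linear_combination h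
      rcases mul_eq_zero.1 h3 with h4 | h4
      · linarith
      · exact h4
    · exfalso
      have h2 := anti hl
      have h3 : (1 / q) ^ 4 < (1 / q) ^ 3 := pow_lt_pow_right_of_lt_one₀ ht0 ht (by norm_num)
      rw [pow_one] at h
      linarith
  · exfalso
    have h2 := anti hi
    have h3 := anti (hi.trans hil)
    -- This is 2/q² < 1/q + 1/q³.
    have h4 : 0 < 1 / q * (1 - 1 / q) ^ 2 := mul_pos ht0 (pow_pos (by linarith) 2)
    nlinarith

lemma encard_one_pair (hq : 1 < q) (hP : q ^ 4 - 2 * q ^ 2 - q - 1 ≤ 0) {v : ℝ}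
    (h0 : (expansions q v).encard = 1) (h1 : (expansions q (v + 1)).encard = 1) :
    q ^ 4 - 2 * q ^ 2 - q - 1 = 0 ∧ (v = altValue q / q ^ 2 ∨ v = altValue q / q ^ 4) := by
  have hb := lt_of_quartic_nonpos hq hP
  have hq2 : q < 2 := by linarith
  have hf := mul_sub_one_sq_lt_one hq hb
  have hq1 : 0 < q - 1 := by linarith
  have hr : 1 < 1 / (q - 1) := by rw [lt_div_iff₀] <;> linarith
  have hapos := altValue_pos hq
  have hsmall : ∀ k : ℕ, altValue q / q ^ (k + 1) ≤ altValue q :=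
    fun k => div_le_self hapos.le (one_le_pow₀ hq.le)
  have hsmall0 : ∀ k : ℕ, 0 < altValue q / q ^ (k + 1) := fun k => by positivity
  have hscale : ∀ k : ℕ, altValue q / q ^ (k + 1) = (1 / q) ^ k / (q ^ 2 - 1) := by
    intro k
    rw [altValue, div_pow, one_pow]
    field_simp
    ring
  have hqq : 0 < q ^ 2 - 1 := by nlinarith
  -- Together with `hscale`, multiplying by `q ^ 2 - 1` turns equations between candidate points
  -- into equations between powers of `1 / q`.
  have hr1 : (1 / (q - 1) - 1) * (q ^ 2 - 1) = (2 - q) * (q + 1) := by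
    field_simp
    ring
  have single : altValue q < 1 → ∀ k : ℕ, altValue q / q ^ (k + 1) ≠ 1 / (q - 1) - 1 := by
    intro ha k hk
    rw [hscale, div_eq_iff hqq.ne', hr1] at hk
    exact inv_pow_ne hq ((altValue_lt_one_iff hq).1 ha) hP k hk
  rcases encard_one_classification hq hq2 hf h0 with rfl | rfl | ⟨ha, j, rfl | rfl⟩
  · rcases encard_one_classification hq hq2 hf h1 with h | h | ⟨ha, k, h | h⟩
    · linarith
    · linarith
    · linarith [hsmall k]
    · exact absurd (by linarith) (single ha k)
  · have := (mem_Icc_of_encard_eq hq (k := 1) one_ne_zero (h1.trans Nat.cast_one.symm)).2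
    linarith
  · rcases encard_one_classification hq hq2 hf h1 with h | h | ⟨-, k, h | h⟩
    · linarith [hsmall0 j]
    · exact absurd (by linarith) (single ha j)
    · linarith [hsmall k, hsmall0 j]
    · have hG := (altValue_lt_one_iff hq).1 ha
      have heq : (1 / q) ^ j + (1 / q) ^ k = (2 - q) * (q + 1) := by
        rw [← hr1, ← div_eq_iff hqq.ne', add_div, ← hscale, ← hscale]
        linarith
      rcases le_total j k with hjk | hjk
      · obtain ⟨hz, rfl, rfl⟩ := inv_pow_add_inv_pow_eq hq hq2 hG hP hjk heq
        exact ⟨hz, Or.inl rfl⟩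
      · obtain ⟨hz, rfl, rfl⟩ := inv_pow_add_inv_pow_eq hq hq2 hG hP hjk
          (by rw [add_comm]; exact heq)
        exact ⟨hz, Or.inr rfl⟩
  · have := (mem_Icc_of_encard_eq hq (k := 1) one_ne_zero (h1.trans Nat.cast_one.symm)).2
    linarith [hsmall j]

lemma bounds_of_quartic_eq_zero (hq : 1 < q) (hP : q ^ 4 - 2 * q ^ 2 - q - 1 = 0) :
    1.7 < q ∧ q < 1.72 := by
  refine ⟨?_, lt_of_quartic_nonpos hq hP.le⟩
  by_contra! h
  nlinarith [mul_nonneg (sub_nonneg.2 h) (sub_nonneg.2 hq.le), sq_nonneg (q ^ 2 - 1.7 ^ 2)]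

/-- The smaller of the two points of the switch region with two expansions in the critical base. -/
noncomputable def switchPoint (q : ℝ) : ℝ := (altValue q / q ^ 4 + 1) / q

lemma altValue_div_add_one (hq : 1 < q) (hP : q ^ 4 - 2 * q ^ 2 - q - 1 = 0) :
    altValue q / q ^ 4 + 1 = 1 / (q - 1) - altValue q / q ^ 2 := by
  have h : q ^ 2 - 1 = (q - 1) * (q + 1) := by ring
  have h1 : q - 1 ≠ 0 := by linarith
  have h2 : q + 1 ≠ 0 := by linarith
  rw [altValue, h]
  field_simp
  linear_combination (q - 1) * hP

lemma altValue_lt_one_of_quartic (hq : 1 < q) (hP : q ^ 4 - 2 * q ^ 2 - q - 1 = 0) :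
    altValue q < 1 := by
  have := bounds_of_quartic_eq_zero hq hP
  rw [altValue_lt_one_iff hq]
  nlinarith

/-- Its two branches are α / q⁴ and the reflection of α / q², where α = `altValue q`; each has one
expansion. -/
lemma encard_switchPoint (hq : 1 < q) (hP : q ^ 4 - 2 * q ^ 2 - q - 1 = 0) :
    (expansions q (switchPoint q)).encard = 2 := by
  have hb := bounds_of_quartic_eq_zero hq hP
  have hq2 : q < 2 := by linarith
  have ha := altValue_lt_one_of_quartic hq hP
  rw [encard_expansions hq, switchPoint, mul_div_cancel₀ _ (by positivity),
    add_sub_cancel_right, encard_altValue_div hq hq2 ha, altValue_div_add_one hq hP,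
    encard_expansions_reflect hq, encard_altValue_div hq hq2 ha]
  norm_num

lemma isLeast_basesWith_two (hq : 1 < q) (hP : q ^ 4 - 2 * q ^ 2 - q - 1 = 0) :
    IsLeast (basesWith 2) q := by
  have hb := bounds_of_quartic_eq_zero hq hP
  refine ⟨⟨⟨hq, by linarith⟩, switchPoint q, (mem_pointsWith hq (by norm_num)).2
    (encard_switchPoint hq hP)⟩, ?_⟩
  rintro p ⟨⟨hp, hp2⟩, x, -, hx⟩
  by_contra! hlt
  have hneg : p ^ 4 - 2 * p ^ 2 - p - 1 < 0 := by
    -- The product is P(q) - P(p) for the quartic P.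
    have h1 : 0 < (q - p) * (q ^ 3 + q ^ 2 * p + q * p ^ 2 + p ^ 3 - 2 * (q + p) - 1) := by
      apply mul_pos (by linarith)
      have h2 : 1.7 ^ 2 < q ^ 2 := by gcongr; linarith
      have h3 : 1 < p ^ 2 := by nlinarith
      nlinarith
    nlinarith
  obtain ⟨v, h0, h1⟩ := exists_encard_one_pair hp hp2 hx
  have := (encard_one_pair hp hneg.le h0 h1).1
  linarith

lemma exists_quartic_root : ∃ q : ℝ, 1 < q ∧ q ^ 4 - 2 * q ^ 2 - q - 1 = 0 := by
  have hc : ContinuousOn (fun q : ℝ => q ^ 4 - 2 * q ^ 2 - q - 1) (Icc 1.7 1.72) := by fun_prop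
  obtain ⟨q, hq, h⟩ := intermediate_value_Icc (by norm_num) hc
    (show (0 : ℝ) ∈ Icc _ _ by constructor <;> norm_num)
  exact ⟨q, by linarith [hq.1], h⟩

end Equation

/-! ### Accumulation points in the critical base. -/

section AccumulationPoints

variable {q : ℝ}

lemma mul_mem_of_frequently {M : Set ℝ} {x b : ℝ} (hq : 1 < q)
    (h : ∃ᶠ y in 𝓝[≠] x, q * y - b ∈ M) : AccPt (q * x - b) (𝓟 M) := by
  rw [accPt_iff_frequently_nhdsNE]
  refine Tendsto.frequently ?_ h
  refine tendsto_nhdsWithin_iff.2 ⟨?_, ?_⟩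
  · exact (Continuous.tendsto (by fun_prop) x).mono_left nhdsWithin_le_nhds
  · filter_upwards [self_mem_nhdsWithin] with y hy
    intro h
    apply hy
    have : q * y = q * x := by
      have h' : q * y - b = q * x - b := h
      linarith
    exact mul_left_cancel₀ (by positivity) this

lemma mem_cases_of_encard_two (hq : 1 < q) (hP : q ^ 4 - 2 * q ^ 2 - q - 1 = 0) {y : ℝ}
    (hy : y ∈ pointsWith q 2) : (q * y < 1 ∧ q * y ∈ pointsWith q 2) ∨
      (1 / (q - 1) < q * y ∧ q * y - 1 ∈ pointsWith q 2) ∨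
      y ∈ ({(altValue q / q ^ 2 + 1) / q, (altValue q / q ^ 4 + 1) / q} : Set ℝ) := by
  have hb := bounds_of_quartic_eq_zero hq hP
  have hq0 : q ≠ 0 := by positivity
  simp only [mem_pointsWith hq two_ne_zero] at *
  rcases encard_two_cases hq (by linarith) hy with h | h | ⟨h1, h2⟩
  · exact Or.inl ⟨h, (encard_mul_of_lt hq h).trans hy⟩
  · exact Or.inr (Or.inl ⟨h, (encard_mul_sub_one_of_lt hq h).trans hy⟩)
  · right; right
    rcases (encard_one_pair hq hP.le h2 (by simpa using h1)).2 with h | h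
    · left
      rw [← h]
      field_simp
      ring
    · right
      rw [mem_singleton_iff, ← h]
      field_simp
      ring

/-- Only two points of the set branch inside the switch region, and finitely many points do not
affect accumulation. One of the two forced branches thus occurs frequently near `x`. -/
lemma accPt_step (hq : 1 < q) (hP : q ^ 4 - 2 * q ^ 2 - q - 1 = 0) {x : ℝ}
    (hx : AccPt x (𝓟 (pointsWith q 2))) :
    (q * x ≤ 1 ∧ AccPt (q * x) (𝓟 (pointsWith q 2))) ∨
      (1 / (q - 1) ≤ q * x ∧ AccPt (q * x - 1) (𝓟 (pointsWith q 2))) := by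
  rw [accPt_iff_frequently_nhdsNE] at hx
  have hfin : ∀ᶠ y in 𝓝[≠] x,
      y ∉ ({(altValue q / q ^ 2 + 1) / q, (altValue q / q ^ 4 + 1) / q} : Set ℝ) := by
    have h := ((toFinite ({(altValue q / q ^ 2 + 1) / q,
      (altValue q / q ^ 4 + 1) / q} \ {x} : Set ℝ)).isClosed.isOpen_compl).mem_nhds
      (show x ∈ _ from fun h => h.2 rfl)
    filter_upwards [nhdsWithin_le_nhds h, self_mem_nhdsWithin] with y hy hne hmem
    exact hy ⟨hmem, hne⟩
  have h := (hx.and_eventually hfin).mono (q := fun y =>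
    (q * y < 1 ∧ q * y ∈ pointsWith q 2) ∨ (1 / (q - 1) < q * y ∧ q * y - 1 ∈ pointsWith q 2)) (by
      rintro y ⟨hy, hn⟩
      rcases mem_cases_of_encard_two hq hP hy with h | h | h
      · exact Or.inl h
      · exact Or.inr h
      · exact absurd h hn)
  have hcont : Tendsto (fun y => q * y) (𝓝[≠] x) (𝓝 (q * x)) :=
    (Continuous.tendsto (by fun_prop) x).mono_left nhdsWithin_le_nhds
  rcases frequently_or_distrib.1 h with h | h
  · left
    refine ⟨le_of_tendsto_of_frequently hcont (h.mono fun y hy => hy.1.le), ?_⟩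
    simpa using mul_mem_of_frequently (b := 0) hq (h.mono fun y hy => by simpa using hy.2)
  · right
    exact ⟨ge_of_tendsto_of_frequently hcont (h.mono fun y hy => hy.1.le),
      mul_mem_of_frequently hq (h.mono fun y hy => hy.2)⟩

lemma not_accPt_switch (hq : 1 < q) (hP : q ^ 4 - 2 * q ^ 2 - q - 1 = 0) {x : ℝ}
    (h1 : 1 < q * x) (h2 : q * x < 1 / (q - 1)) : ¬ AccPt x (𝓟 (pointsWith q 2)) := by
  intro h
  rcases accPt_step hq hP h with h | h <;> linarith [h.1]

lemma accPt_subset (hq : 1 < q) (hP : q ^ 4 - 2 * q ^ 2 - q - 1 = 0) {x : ℝ}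
    (hx : AccPt x (𝓟 (pointsWith q 2))) : x ∈ pointsWith q 1 := by
  obtain ⟨hb, hb'⟩ := bounds_of_quartic_eq_zero hq hP
  have hf := mul_sub_one_sq_lt_one hq hb'
  have hq1 : 0 < q - 1 := by linarith
  have hr : (1 / (q - 1)) * (q - 1) = 1 := by field_simp
  have hr1 : q * (q - 1) < 1 / (q - 1) := by
    rw [lt_div_iff₀ hq1]
    linarith
  have hr2 : 1 < 1 / (q - 1) := by rw [lt_div_iff₀] <;> linarith
  have hr3 : 1 / (q - 1) < 1.43 := by rw [div_lt_iff₀ hq1]; linarith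
  rw [mem_pointsWith hq one_ne_zero, Nat.cast_one]
  refine encard_eq_one_of_invariant hq (by linarith)
    (D := {y | AccPt y (𝓟 (pointsWith q 2))}) ?_ ?_ hx
  · intro y hy
    exact closure_minimal (fun z hz => hz.1) isClosed_Icc (mem_closure_iff_clusterPt.2 hy.clusterPt)
  · intro y hy
    rcases accPt_step hq hP hy with ⟨h1, h2⟩ | ⟨h1, h2⟩
    · refine Or.inl ⟨lt_of_le_of_ne h1 fun heq => ?_, h2⟩
      -- At the boundary `q * y = 1`, the orbit continues 1, `q - 1`, and the latter lies strictly
      -- inside the switch region. The other boundary is the mirror image.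
      rw [heq] at h2
      rcases accPt_step hq hP h2 with ⟨h3, -⟩ | ⟨-, h4⟩
      · linarith
      · rw [mul_one] at h4
        exact not_accPt_switch hq hP (by nlinarith) hr1 h4
    · refine Or.inr ⟨lt_of_le_of_ne h1 fun heq => ?_, h2⟩
      rw [← heq] at h2
      rcases accPt_step hq hP h2 with ⟨-, h3⟩ | ⟨h3, -⟩
      · refine not_accPt_switch hq hP ?_ ?_ h3
        · nlinarith
        · nlinarith
      · nlinarith

/-- The map on values induced by prepending the digits `01`. -/
noncomputable def prependPair (q z : ℝ) : ℝ := (z + 1) / q / q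

/-- The lower bound forces the prepended digit 1 and the upper bound the 0 before it, so the number
of expansions is preserved. -/
lemma prependPair_orbit (hq : 1 < q) (hP : q ^ 4 - 2 * q ^ 2 - q - 1 = 0) (m : ℕ) :
    (expansions q ((prependPair q)^[m] (switchPoint q))).encard = 2 ∧
      1 / (q - 1) - 1 < (prependPair q)^[m] (switchPoint q) ∧
      (prependPair q)^[m] (switchPoint q) < q - 1 := by
  obtain ⟨hb, hb'⟩ := bounds_of_quartic_eq_zero hq hP
  have hq1 : 0 < q - 1 := by linarith
  have hr1 : 1 / (q - 1) < 1.43 := by rw [div_lt_iff₀ hq1]; linarith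
  induction m with
  | zero =>
    refine ⟨encard_switchPoint hq hP, ?_, ?_⟩
    · have h : 1 / q ≤ switchPoint q := by
        rw [switchPoint]
        have := altValue_pos hq
        gcongr
        linarith [show 0 < altValue q / q ^ 4 by positivity]
      have h2 : 0.5 < 1 / q := by rw [lt_div_iff₀] <;> linarith
      simp only [Function.iterate_zero, id]
      linarith
    · simp only [Function.iterate_zero, id, switchPoint]
      rw [div_lt_iff₀ (by positivity)]
      have h4 : q ^ 4 = 2 * q ^ 2 + q + 1 := by linarith
      have ha := altValue_lt_one_of_quartic hq hP
      have : altValue q / q ^ 4 < 1 / q ^ 4 := by gcongr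
      have h5 : 1 / q ^ 4 < 0.13 := by
        rw [div_lt_iff₀ (by positivity)]
        nlinarith
      nlinarith
  | succ m ih =>
    obtain ⟨h1, h2, h3⟩ := ih
    rw [Function.iterate_succ_apply']
    set z := (prependPair q)^[m] (switchPoint q)
    have h4 : (z + 1) / q < 1 := by
      rw [div_lt_one] <;> linarith
    refine ⟨?_, ?_, ?_⟩
    · rw [prependPair, encard_cons_zero hq h4, encard_cons_one hq (by linarith), h1]
    · have hz : 1.38 < z + 1 := by
        have : 1.38 < 1 / (q - 1) := by rw [lt_div_iff₀ hq1]; linarith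
        linarith
      have : 1.38 / q / q < prependPair q z := by
        unfold prependPair
        gcongr
      refine lt_trans ?_ this
      have h5 : 0.45 < 1.38 / q / q := by
        rw [lt_div_iff₀ (by positivity), lt_div_iff₀ (by positivity)]
        nlinarith
      linarith
    · unfold prependPair
      rw [div_lt_iff₀ (by positivity)]
      nlinarith

/-- Prepending 01 is an affine contraction of ratio 1/q² whose fixed point is the value of (01)^∞.
-/
lemma tendsto_prependPair_orbit (hq : 1 < q) :
    Tendsto (fun m => (prependPair q)^[m] (switchPoint q)) atTop (𝓝 (altValue q / q)) := by
  have hqq : q ^ 2 - 1 ≠ 0 := by nlinarith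
  have hfix : prependPair q (altValue q / q) = altValue q / q := by
    rw [prependPair, altValue]
    field_simp
    ring
  have hstep : ∀ z w, prependPair q (z + w) = prependPair q z + w / q ^ 2 := by
    intro z w
    rw [prependPair, prependPair]
    field_simp
    ring
  have hform : ∀ m, (prependPair q)^[m] (switchPoint q)
      = altValue q / q + (switchPoint q - altValue q / q) / (q ^ 2) ^ m := by
    intro m
    induction m with
    | zero => simp
    | succ m ih =>
      rw [Function.iterate_succ_apply', ih]
      rw [hstep, hfix, pow_succ (q ^ 2) m, div_div]
  simp only [hform]
  have : Tendsto (fun m : ℕ => (switchPoint q - altValue q / q) / (q ^ 2) ^ m) atTop (𝓝 0) :=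
    tendsto_const_nhds.div_atTop (tendsto_pow_atTop_atTop_of_one_lt (by nlinarith))
  simpa using this.const_add (altValue q / q)

lemma encard_div_pow (hq : 1 < q) {z : ℝ} (hz : (expansions q z).encard = 2)
    (hz1 : z < 1) (k : ℕ) : (expansions q (z / q ^ k)).encard = 2 := by
  have h0 := (mem_Icc_of_encard_eq hq two_ne_zero hz).1
  induction k with
  | zero => simpa using hz
  | succ k ih =>
    rw [pow_succ, ← div_div, encard_cons_zero hq, ih]
    exact (div_le_self h0 (one_le_pow₀ hq.le)).trans_lt hz1

lemma reflect_mem_closure (hq : 1 < q) {x : ℝ} (hx : x ∈ closure (pointsWith q 2)) :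
    1 / (q - 1) - x ∈ closure (pointsWith q 2) := by
  refine map_mem_closure (f := fun y => 1 / (q - 1) - y) (by fun_prop) hx fun y hy => ?_
  rw [mem_pointsWith hq two_ne_zero] at *
  rw [encard_expansions_reflect hq, hy]

lemma subset_closure (hq : 1 < q) (hP : q ^ 4 - 2 * q ^ 2 - q - 1 = 0) :
    pointsWith q 1 ⊆ closure (pointsWith q 2) := by
  obtain ⟨hb, hb'⟩ := bounds_of_quartic_eq_zero hq hP
  have hmem : ∀ m k : ℕ,
      (prependPair q)^[m] (switchPoint q) / q ^ k ∈ pointsWith q 2 := by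
    intro m k
    obtain ⟨h1, -, h3⟩ := prependPair_orbit hq hP m
    exact (mem_pointsWith hq two_ne_zero).2 (encard_div_pow hq h1 (by linarith) k)
  have hzero : (0 : ℝ) ∈ closure (pointsWith q 2) :=
    mem_closure_of_tendsto (f := fun k : ℕ => (prependPair q)^[0] (switchPoint q) / q ^ k)
      (tendsto_const_nhds.div_atTop (tendsto_pow_atTop_atTop_of_one_lt hq))
      (Eventually.of_forall fun k => hmem 0 k)
  have halt : ∀ k : ℕ, altValue q / q ^ (k + 1) ∈ closure (pointsWith q 2) := by
    intro k
    rw [pow_succ', ← div_div]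
    exact mem_closure_of_tendsto ((tendsto_prependPair_orbit hq).div_const (q ^ k))
      (Eventually.of_forall fun m => hmem m k)
  intro x hx
  rw [mem_pointsWith hq one_ne_zero, Nat.cast_one] at hx
  rcases encard_one_classification hq (by linarith) (mul_sub_one_sq_lt_one hq hb') hx with
    rfl | rfl | ⟨-, k, rfl | rfl⟩
  · exact hzero
  · simpa using reflect_mem_closure hq hzero
  · exact halt k
  · exact reflect_mem_closure hq (halt k)

lemma disjoint_pointsWith {j k : ℕ} (h : j ≠ k) : Disjoint (pointsWith q j) (pointsWith q k) := by
  rw [Set.disjoint_left]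
  intro x hj hk
  exact h (by exact_mod_cast hj.2.symm.trans hk.2)

lemma setOf_accPt_pointsWith_two (hq : 1 < q) (hP : q ^ 4 - 2 * q ^ 2 - q - 1 = 0) :
    {x : ℝ | AccPt x (𝓟 (pointsWith q 2))} = pointsWith q 1 := by
  refine Subset.antisymm (fun x hx => accPt_subset hq hP hx) fun x hx => ?_
  have hne : x ∉ pointsWith q 2 := (disjoint_pointsWith (by norm_num)).notMem_of_mem_left hx
  have h := mem_closure_iff_clusterPt.1 (subset_closure hq hP hx)
  change AccPt x _
  rwa [accPt_principal_iff_clusterPt, sdiff_singleton_eq_self hne]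

end AccumulationPoints

end BaseExpansion

theorem corollary3p7 :
    IsLeast (BaseExpansion.basesWith 2) BaseExpansion.q₂ ∧
    {x : ℝ | AccPt x (Filter.principal (BaseExpansion.M 2))} = BaseExpansion.M 1 ∧
    DiscreteTopology (BaseExpansion.M 2) ∧
    (BaseExpansion.M 2).Countable ∧
    (BaseExpansion.M 2).Infinite ∧
    ¬ IsClosed (BaseExpansion.M 2) := by
  obtain ⟨q, hq, hP⟩ := BaseExpansion.exists_quartic_root
  have hleast := BaseExpansion.isLeast_basesWith_two hq hP
  have hq₂ : BaseExpansion.q₂ = q := hleast.csInf_eq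
  have hacc := BaseExpansion.setOf_accPt_pointsWith_two hq hP
  have hb := BaseExpansion.bounds_of_quartic_eq_zero hq hP
  have hzero : (0 : ℝ) ∈ BaseExpansion.pointsWith q 1 :=
    (BaseExpansion.mem_pointsWith hq one_ne_zero).2
      ((BaseExpansion.encard_zero_eq_one hq (by linarith)).trans Nat.cast_one.symm)
  have hdisj : Disjoint (BaseExpansion.pointsWith q 1) (BaseExpansion.pointsWith q 2) :=
    BaseExpansion.disjoint_pointsWith (by norm_num)
  have hdiscrete : DiscreteTopology (BaseExpansion.pointsWith q 2) :=
    discreteTopology_of_noAccPts fun x hx h => hdisj.notMem_of_mem_right hx (hacc.subset h)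
  have hzero_acc : AccPt (0 : ℝ) (𝓟 (BaseExpansion.pointsWith q 2)) := hacc.superset hzero
  unfold BaseExpansion.M
  rw [hq₂]
  refine ⟨hleast, hacc, hdiscrete, ?_, ?_, ?_⟩
  -- A subspace of ℝ is separable, and a discrete separable space is countable.
  · exact countable_coe_iff.1
      (TopologicalSpace.separableSpace_iff_countable.1 inferInstance)
  · intro hfin
    rw [accPt_principal_iff_clusterPt, ← mem_closure_iff_clusterPt,
      (hfin.subset sdiff_subset).isClosed.closure_eq] at hzero_acc
    exact hzero_acc.2 rfl
  · intro hclosed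
    exact hdisj.notMem_of_mem_left hzero (isClosed_iff_accPt.1 hclosed 0 hzero_acc)
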